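/- **Proposition 1.** Let $p\ge n$ and let $\Omega\in\mathbb{R}^{p\times n}$ be a (redundant) analysis operator of full column rank $n$. Let $w\in\mathbb{R}^p$ be a vector of nonnegative weights, put $\|y\|_{1,w}=\sum_{i=1}^p w_i|y_i|$ for $y\in\mathbb{R}^p$, and let $x\in\mathbb{R}^n$ be an $s$-analysis-sparse vector, that is, $\Omega x$ has at most $s$ nonzero entries. For a function $f:\mathbb{R}^d\to\mathbb{R}$ and $u\in\mathbb{R}^d$ let $$\mathcal{D}(f,u)=\bigcup_{t>0}\{z\in\mathbb{R}^d: f(u+tz)\le f(u)\}$$ be the descent cone of $f$ at $u$. For a closed convex cone $C\subseteq\mathbb{R}^d$ let $\delta(C)=\mathbb{E}\,\|\mathcal{P}_C(g)\|_2^2$ be its statistical dimension, where $g$ is a standard Gaussian vector in $\mathbb{R}^d$ and $\mathcal{P}_C$ is the orthogonal projection onto $C$. Let $\kappa(\Omega)=\|\Omega\|_{2\to2}\,\|\Omega^\dagger\|_{2\to2}$, where $\Omega^\dagger$ is the Moore–Penrose pseudoinverse of $\Omega$. Then $$\delta\big(\mathcal{D}(\|\Omega\,\cdot\|_{1,w},x)\big)\le\kappa^2(\Omega)\,\delta\big(\mathcal{D}(\|\cdot\|_{1,w},\Omega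 x)\big).$$ Moreover, if $p=n$ and $\Omega$ is nonsingular, then $$\frac{1}{\kappa^2(\Omega)}\,\delta\big(\mathcal{D}(\|\cdot\|_{1,w},\Omega x)\big)\le\delta\big(\mathcal{D}(\|\Omega\,\cdot\|_{1,w},x)\big)\le\kappa^2(\Omega)\,\delta\big(\mathcal{D}(\|\cdot\|_{1,w},\Omega x)\big).$$ -/

import Mathlib

namespace AnalysisRecovery

open MeasureTheory ProbabilityTheory Filter Topology
open scoped Matrix RealInnerProductSpace

/-! ### Matrices: operator norm, pseudoinverse, condition number -/

/-- The image `Ω x` as a vector of Euclidean space. -/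
noncomputable def apply {p n : ℕ} (Ω : Matrix (Fin p) (Fin n) ℝ) (x : EuclideanSpace ℝ (Fin n)) :
    EuclideanSpace ℝ (Fin p) :=
  Matrix.toEuclideanLin Ω x

/-- The operator norm `‖A‖_{2→2}` of a rectangular real matrix. -/
noncomputable def opNorm {p n : ℕ} (A : Matrix (Fin p) (Fin n) ℝ) : ℝ :=
  ‖LinearMap.toContinuousLinearMap (Matrix.toEuclideanLin A)‖

/-- The four Penrose equations: `B` is a Moore–Penrose pseudoinverse of `A`. -/
structure IsPseudoinverse {p n : ℕ} (A : Matrix (Fin p) (Fin n) ℝ)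
    (B : Matrix (Fin n) (Fin p) ℝ) : Prop where
  mul_mul_left : A * B * A = A
  mul_mul_right : B * A * B = B
  symm_left : (A * B)ᵀ = A * B
  symm_right : (B * A)ᵀ = B * A

/-- A matrix has at most one Moore–Penrose pseudoinverse. -/
theorem IsPseudoinverse.unique {p n : ℕ} {A : Matrix (Fin p) (Fin n) ℝ}
    {B C : Matrix (Fin n) (Fin p) ℝ} (hB : IsPseudoinverse A B) (hC : IsPseudoinverse A C) :
    B = C := by
  have e1 : A * B = A * C := by
    calc A * B = (A * B)ᵀ := hB.symm_left.symm
      _ = (A * C * A * B)ᵀ := by rw [hC.mul_mul_left]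
      _ = (A * B)ᵀ * (A * C)ᵀ := by rw [Matrix.mul_assoc (A * C), Matrix.transpose_mul]
      _ = A * B * (A * C) := by rw [hB.symm_left, hC.symm_left]
      _ = A * B * A * C := by rw [Matrix.mul_assoc (A * B)]
      _ = A * C := by rw [hB.mul_mul_left]
  have e2 : B * A = C * A := by
    calc B * A = (B * A)ᵀ := hB.symm_right.symm
      _ = (B * (A * C * A))ᵀ := by rw [hC.mul_mul_left]
      _ = (B * A * (C * A))ᵀ := by simp only [Matrix.mul_assoc]
      _ = (C * A)ᵀ * (B * A)ᵀ := by rw [Matrix.transpose_mul]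
      _ = C * A * (B * A) := by rw [hB.symm_right, hC.symm_right]
      _ = C * (A * B * A) := by simp only [Matrix.mul_assoc]
      _ = C * A := by rw [hB.mul_mul_left]
  calc B = B * A * B := hB.mul_mul_right.symm
    _ = C * (A * B) := by rw [e2, Matrix.mul_assoc]
    _ = C * A * C := by rw [e1, Matrix.mul_assoc]
    _ = C := hC.mul_mul_right

/-- A matrix of full column rank has an invertible Gram matrix. -/
theorem isUnit_det_gram {p n : ℕ} {A : Matrix (Fin p) (Fin n) ℝ} (hA : A.rank = n) :
    IsUnit (Aᵀ * A).det := by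
  have h : (Aᵀ * A).rank = n := by rw [Matrix.rank_transpose_mul_self, hA]
  rw [← Matrix.isUnit_iff_isUnit_det, ← Matrix.linearIndependent_cols_iff_isUnit,
    linearIndependent_iff_card_eq_finrank_span, Fintype.card_fin, Set.finrank,
    ← Matrix.rank_eq_finrank_span_cols, h]

/-- For a matrix of full column rank, `(AᵀA)⁻¹Aᵀ` is the Moore–Penrose pseudoinverse. -/
theorem isPseudoinverse_of_rank {p n : ℕ} {A : Matrix (Fin p) (Fin n) ℝ} (hA : A.rank = n) :
    IsPseudoinverse A ((Aᵀ * A)⁻¹ * Aᵀ) := by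
  have hu := isUnit_det_gram hA
  have h1 : (Aᵀ * A)⁻¹ * Aᵀ * A = 1 := by
    rw [Matrix.mul_assoc, Matrix.nonsing_inv_mul _ hu]
  refine ⟨?_, ?_, ?_, ?_⟩
  · rw [Matrix.mul_assoc, h1, Matrix.mul_one]
  · rw [h1, Matrix.one_mul]
  · simp [Matrix.transpose_mul, Matrix.transpose_nonsing_inv, Matrix.mul_assoc]
  · rw [h1, Matrix.transpose_one]

open Classical in
/-- The Moore–Penrose pseudoinverse `A†`. -/
noncomputable def pinv {p n : ℕ} (A : Matrix (Fin p) (Fin n) ℝ) : Matrix (Fin n) (Fin p) ℝ :=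
  if h : ∃ B, IsPseudoinverse A B then h.choose else 0

theorem pinv_eq {p n : ℕ} {A : Matrix (Fin p) (Fin n) ℝ} {B : Matrix (Fin n) (Fin p) ℝ}
    (hB : IsPseudoinverse A B) : pinv A = B := by
  have h : ∃ B, IsPseudoinverse A B := ⟨B, hB⟩
  rw [pinv, dif_pos h]
  exact h.choose_spec.unique hB

theorem pinv_eq_of_rank {p n : ℕ} {A : Matrix (Fin p) (Fin n) ℝ} (hA : A.rank = n) :
    pinv A = (Aᵀ * A)⁻¹ * Aᵀ :=
  pinv_eq (isPseudoinverse_of_rank hA)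

/-- The condition number `κ(A) = ‖A‖_{2→2} ‖A†‖_{2→2}`. -/
noncomputable def condNumber {p n : ℕ} (A : Matrix (Fin p) (Fin n) ℝ) : ℝ :=
  opNorm A * opNorm (pinv A)

/-! ### Weighted norms, analysis sparsity, descent cones -/

/-- `x` is `s`-analysis-sparse: `Ω x` has at most `s` nonzero entries. -/
def IsAnalysisSparse {p n : ℕ} (Ω : Matrix (Fin p) (Fin n) ℝ) (s : ℕ)
    (x : EuclideanSpace ℝ (Fin n)) : Prop :=
  {i : Fin p | apply Ω x i ≠ 0}.ncard ≤ s

/-- The weighted `ℓ₁` norm `‖y‖_{1,w} = ∑ᵢ wᵢ |yᵢ|`. -/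
noncomputable def weightedL1 {p : ℕ} (w : Fin p → ℝ) (y : EuclideanSpace ℝ (Fin p)) : ℝ :=
  ∑ i, w i * |y i|

/-- The weighted analysis norm `‖Ω z‖_{1,w}`. -/
noncomputable def weightedAnalysisL1 {p n : ℕ} (Ω : Matrix (Fin p) (Fin n) ℝ) (w : Fin p → ℝ)
    (z : EuclideanSpace ℝ (Fin n)) : ℝ :=
  weightedL1 w (apply Ω z)

/-- The descent cone of `f` at `x`. -/
def descentCone {E : Type*} [AddCommGroup E] [Module ℝ E] (f : E → ℝ) (x : E) : Set E :=
  ⋃ t ∈ Set.Ioi (0 : ℝ), {z : E | f (x + t • z) ≤ f x}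

/-! ### Metric projection and statistical dimension -/

/-- `z` is a point of `C` closest to `g`. -/
def IsNearestPoint {n : ℕ} (C : Set (EuclideanSpace ℝ (Fin n)))
    (g z : EuclideanSpace ℝ (Fin n)) : Prop :=
  z ∈ C ∧ ∀ y ∈ C, ‖z - g‖ ≤ ‖y - g‖

open Classical in
/-- The orthogonal projection `P_C(g) = argmin_{z ∈ C} ‖z - g‖₂` onto a nonempty closed
convex set `C`. -/
noncomputable def metricProj {n : ℕ} (C : Set (EuclideanSpace ℝ (Fin n)))
    (g : EuclideanSpace ℝ (Fin n)) : EuclideanSpace ℝ (Fin n) :=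
  if h : ∃ z, IsNearestPoint C g z then h.choose else 0

/-- The statistical dimension `δ(C) = 𝔼 ‖P_C(g)‖₂²` of a closed convex cone `C`, where `g` is a
standard Gaussian vector. -/
noncomputable def statDim {n : ℕ} (C : Set (EuclideanSpace ℝ (Fin n))) : ℝ :=
  ∫ g, ‖metricProj C g‖ ^ 2 ∂(stdGaussian (EuclideanSpace ℝ (Fin n)))

/-! ### The definitions take no default value on the cones at hand -/

theorem isNearestPoint_iff {n : ℕ} {C : Set (EuclideanSpace ℝ (Fin n))} (hc : Convex ℝ C)
    {g z : EuclideanSpace ℝ (Fin n)} :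
    IsNearestPoint C g z ↔ z ∈ C ∧ ∀ y ∈ C, ⟪g - z, y - z⟫ ≤ 0 := by
  refine and_congr_right fun hz => ?_
  rw [← norm_eq_iInf_iff_real_inner_le_zero hc hz]
  have : Nonempty C := ⟨⟨z, hz⟩⟩
  have hb : BddBelow (Set.range fun y : C => ‖g - y‖) :=
    ⟨0, Set.forall_mem_range.2 fun _ => norm_nonneg _⟩
  constructor
  · intro h
    refine le_antisymm (le_ciInf fun y => ?_) (ciInf_le hb ⟨z, hz⟩)
    rw [norm_sub_rev g z, norm_sub_rev g]
    exact h y y.2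
  · intro h y hy
    rw [norm_sub_rev z g, norm_sub_rev y g, h]
    exact ciInf_le hb ⟨y, hy⟩

theorem metricProj_spec {n : ℕ} {C : Set (EuclideanSpace ℝ (Fin n))} (hn : C.Nonempty)
    (hC : IsClosed C) (hc : Convex ℝ C) (g : EuclideanSpace ℝ (Fin n)) :
    IsNearestPoint C g (metricProj C g) := by
  have h : ∃ z, IsNearestPoint C g z := by
    obtain ⟨v, hv, e⟩ := exists_norm_eq_iInf_of_complete_convex hn hC.isComplete hc g
    exact ⟨v, (isNearestPoint_iff hc).2 ⟨hv, (norm_eq_iInf_iff_real_inner_le_zero hc hv).1 e⟩⟩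
  rw [metricProj, dif_pos h]
  exact h.choose_spec

theorem metricProj_lipschitz {n : ℕ} {C : Set (EuclideanSpace ℝ (Fin n))} (hn : C.Nonempty)
    (hC : IsClosed C) (hc : Convex ℝ C) : LipschitzWith 1 (metricProj C) := by
  refine LipschitzWith.of_dist_le_mul fun g h => ?_
  obtain ⟨hg, hg'⟩ := (isNearestPoint_iff hc).1 (metricProj_spec hn hC hc g)
  obtain ⟨hh, hh'⟩ := (isNearestPoint_iff hc).1 (metricProj_spec hn hC hc h)
  have h1 := hg' _ hh
  have h2 := hh' _ hg
  set a := metricProj C g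
  set b := metricProj C h
  have h3 : ⟪a - b, a - b⟫ ≤ ⟪g - h, a - b⟫ := by
    simp only [inner_sub_left, inner_sub_right] at h1 h2 ⊢
    linarith
  have h4 := real_inner_le_norm (g - h) (a - b)
  rw [real_inner_self_eq_norm_sq] at h3
  rw [dist_eq_norm, dist_eq_norm, NNReal.coe_one, one_mul]
  by_contra! hlt
  nlinarith [norm_nonneg (g - h), norm_nonneg (a - b)]

/-- The integrand of `statDim C` is integrable for every closed convex cone `C`. -/
theorem integrable_metricProj_sq {n : ℕ} {C : Set (EuclideanSpace ℝ (Fin n))} (h0 : 0 ∈ C)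
    (hC : IsClosed C) (hc : Convex ℝ C) :
    Integrable (fun g => ‖metricProj C g‖ ^ 2) (stdGaussian (EuclideanSpace ℝ (Fin n))) := by
  have hL := metricProj_lipschitz ⟨0, h0⟩ hC hc
  have hg : Integrable (fun g : EuclideanSpace ℝ (Fin n) => ‖g‖ ^ 2) (stdGaussian _) :=
    (IsGaussian.memLp_two_id (μ := stdGaussian (EuclideanSpace ℝ (Fin n)))).integrable_norm_pow
      two_ne_zero
  have hz : metricProj C 0 = 0 := by
    have := (metricProj_spec ⟨0, h0⟩ hC hc 0).2 0 h0
    simpa using this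
  refine hg.mono' (hL.continuous.norm.pow 2).aestronglyMeasurable (ae_of_all _ fun g => ?_)
  have := hL.dist_le_mul g 0
  rw [hz, dist_zero_right, dist_zero_right, NNReal.coe_one, one_mul] at this
  rw [Real.norm_of_nonneg (by positivity)]
  gcongr

/-- The one-sided directional derivative of the absolute value at `a` in direction `b`. -/
noncomputable def absDir (a b : ℝ) : ℝ := if a = 0 then |b| else SignType.sign a * b

theorem absDir_le (a b : ℝ) {t : ℝ} (ht : 0 < t) : |a| + t * absDir a b ≤ |a + t * b| := by
  unfold absDir
  split_ifs with h
  · simp [h, abs_mul, abs_of_pos ht]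
  · rcases lt_or_gt_of_ne h with h | h
    · simp only [abs_of_neg h, sign_neg h, SignType.coe_neg_one]
      nlinarith [neg_abs_le (a + t * b)]
    · simp only [abs_of_pos h, sign_pos h, SignType.coe_one]
      nlinarith [le_abs_self (a + t * b)]

theorem eventually_absDir (a b : ℝ) :
    ∀ᶠ t in 𝓝[>] (0 : ℝ), |a + t * b| = |a| + t * absDir a b := by
  unfold absDir
  have hlim : Tendsto (fun t : ℝ => a + t * b) (𝓝[>] 0) (𝓝 a) := by
    have : Continuous fun t : ℝ => a + t * b := by fun_prop
    simpa using (this.tendsto 0).mono_left nhdsWithin_le_nhds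
  rcases lt_trichotomy a 0 with h | h | h
  · filter_upwards [hlim.eventually_lt_const h] with t ht
    rw [if_neg h.ne, abs_of_neg ht, abs_of_neg h, sign_neg h]
    simp only [SignType.coe_neg_one]
    ring
  · filter_upwards [self_mem_nhdsWithin] with t ht
    simp [h, abs_mul, abs_of_pos (show (0 : ℝ) < t from ht)]
  · filter_upwards [hlim.eventually_const_lt h] with t ht
    rw [if_neg h.ne', abs_of_pos ht, abs_of_pos h, sign_pos h]
    simp

/-- For nonnegative weights, the descent cone of `z ↦ ‖L z‖_{1,w}` is cut out by the one-sided
directional derivative. -/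
theorem mem_descentCone_iff {p n : ℕ} {w : Fin p → ℝ} (hw : ∀ i, 0 ≤ w i)
    (L : EuclideanSpace ℝ (Fin n) →ₗ[ℝ] EuclideanSpace ℝ (Fin p))
    (x z : EuclideanSpace ℝ (Fin n)) :
    z ∈ descentCone (fun y => weightedL1 w (L y)) x ↔ ∑ i, w i * absDir (L x i) (L z i) ≤ 0 := by
  simp only [descentCone, Set.mem_iUnion, Set.mem_ofPred_eq, Set.mem_Ioi, exists_prop, weightedL1,
    map_add, map_smul, PiLp.add_apply, PiLp.smul_apply, smul_eq_mul]
  constructor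
  · rintro ⟨t, ht, h⟩
    have h1 : ∑ i, w i * (|L x i| + t * absDir (L x i) (L z i)) ≤ ∑ i, w i * |L x i| :=
      (Finset.sum_le_sum fun i _ =>
        mul_le_mul_of_nonneg_left (absDir_le _ _ ht) (hw i)).trans h
    have h2 : ∑ i, w i * (|L x i| + t * absDir (L x i) (L z i))
        = ∑ i, w i * |L x i| + t * ∑ i, w i * absDir (L x i) (L z i) := by
      rw [Finset.mul_sum, ← Finset.sum_add_distrib]
      exact Finset.sum_congr rfl fun i _ => by ring
    by_contra! hpos
    nlinarith [mul_pos ht hpos]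
  · intro h
    have hev := eventually_all.2 fun i => eventually_absDir (L x i) (L z i)
    obtain ⟨t, ht, ht0⟩ := (hev.and self_mem_nhdsWithin).exists
    have ht0' : (0 : ℝ) < t := ht0
    refine ⟨t, ht0', ?_⟩
    have h2 : ∑ i, w i * |L x i + t * L z i|
        = ∑ i, w i * |L x i| + t * ∑ i, w i * absDir (L x i) (L z i) := by
      rw [Finset.mul_sum, ← Finset.sum_add_distrib]
      exact Finset.sum_congr rfl fun i _ => by rw [ht i]; ring
    nlinarith [mul_nonneg ht0'.le (neg_nonneg.2 h)]

theorem continuous_absDir (a : ℝ) : Continuous (absDir a) := by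
  unfold absDir
  split_ifs <;> fun_prop

theorem absDir_convex (a : ℝ) {b c u v : ℝ} (hu : 0 ≤ u) (hv : 0 ≤ v) :
    absDir a (u * b + v * c) ≤ u * absDir a b + v * absDir a c := by
  unfold absDir
  split_ifs
  · refine (abs_add_le _ _).trans_eq ?_
    rw [abs_mul, abs_mul, abs_of_nonneg hu, abs_of_nonneg hv]
  · exact le_of_eq (by ring)

/-- The descent cone of a weighted `ℓ₁` norm composed with a linear map is a closed convex set
containing the origin. -/
theorem descentCone_weighted {p n : ℕ} {w : Fin p → ℝ} (hw : ∀ i, 0 ≤ w i)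
    (L : EuclideanSpace ℝ (Fin n) →ₗ[ℝ] EuclideanSpace ℝ (Fin p))
    (x : EuclideanSpace ℝ (Fin n)) :
    (0 : EuclideanSpace ℝ (Fin n)) ∈ descentCone (fun y => weightedL1 w (L y)) x ∧
    IsClosed (descentCone (fun y => weightedL1 w (L y)) x) ∧
    Convex ℝ (descentCone (fun y => weightedL1 w (L y)) x) := by
  have hE : descentCone (fun y => weightedL1 w (L y)) x
      = {z | ∑ i, w i * absDir (L x i) (L z i) ≤ 0} :=
    Set.ext fun z => mem_descentCone_iff hw L x z
  refine ⟨?_, ?_, ?_⟩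
  · rw [mem_descentCone_iff hw]
    simp [absDir]
  · rw [hE]
    have hL : Continuous L := L.continuous_of_finiteDimensional
    refine isClosed_le (continuous_finsetSum _ fun i _ => continuous_const.mul
      ((continuous_absDir _).comp ?_)) continuous_const
    fun_prop
  · rw [hE]
    intro y hy z hz u v hu hv _
    simp only [Set.mem_ofPred_eq, map_add, map_smul, PiLp.add_apply, PiLp.smul_apply,
      smul_eq_mul] at hy hz ⊢
    have h1 : ∑ i, w i * absDir (L x i) (u * L y i + v * L z i)
        ≤ ∑ i, (u * (w i * absDir (L x i) (L y i)) + v * (w i * absDir (L x i) (L z i))) :=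
      Finset.sum_le_sum fun i _ =>
        (mul_le_mul_of_nonneg_left (absDir_convex _ hu hv) (hw i)).trans_eq (by ring)
    rw [Finset.sum_add_distrib, ← Finset.mul_sum, ← Finset.mul_sum] at h1
    nlinarith [mul_nonneg hu (neg_nonneg.2 hy), mul_nonneg hv (neg_nonneg.2 hz)]

/-- The two statistical dimensions to be compared are expectations of integrable functions. -/
theorem integrable_statDim_descentCones {p n : ℕ} (Ω : Matrix (Fin p) (Fin n) ℝ)
    {w : Fin p → ℝ} (hw : ∀ i, 0 ≤ w i) (x : EuclideanSpace ℝ (Fin n)) :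
    Integrable (fun g => ‖metricProj (descentCone (weightedAnalysisL1 Ω w) x) g‖ ^ 2)
      (stdGaussian (EuclideanSpace ℝ (Fin n))) ∧
    Integrable (fun g => ‖metricProj (descentCone (weightedL1 w) (apply Ω x)) g‖ ^ 2)
      (stdGaussian (EuclideanSpace ℝ (Fin p))) := by
  obtain ⟨a, b, c⟩ := descentCone_weighted hw (Matrix.toEuclideanLin Ω) x
  obtain ⟨a', b', c'⟩ := descentCone_weighted hw LinearMap.id (apply Ω x)
  exact ⟨integrable_metricProj_sq a b c, integrable_metricProj_sq a' b' c'⟩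

end AnalysisRecovery

/-! The descent cone `C` of the analysis norm at `x` is the preimage under `Ω` of the descent cone
`D` of the weighted norm at `Ω x`, and full column rank makes `B = Ω†` a left inverse of `A = Ω`.
The rest concerns closed convex cones with `A C ⊆ D` and `B A = id`.

For `u = P_C g` one has `‖u‖² = ⟪g, u⟫ = ⟪B* g, A u⟫`, and `⟪v, y⟫ ≤ ‖P_D v‖ ‖y‖` for `y ∈ D`. The
vector `B* g` has covariance `B* B`, which is dominated by `‖B‖² I` but in general differs from it.
Since `⟪B* g, A u⟫` is the average of `⟪B* g ± h, A u⟫`, any `h` may be added symmetrically at no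
cost (`norm_metricProj_sq_le`). Take `h = S g'` with `g'` an independent standard Gaussian and `B* B
+ S S* = ‖B‖² I` (`exists_adjoint_norm_sq_add`): then both `B* g ± h` are distributed as `‖B‖` times
a standard Gaussian (`map_add_stdGaussian_prod`), and taking expectations gives `δ(C) ≤ ‖A‖² ‖B‖²
δ(D)`.

For nonsingular `Ω` the roles of `Ω` and `Ω†` can be exchanged, which yields the lower bound. -/

namespace AnalysisRecovery

open MeasureTheory ProbabilityTheory
open scoped RealInnerProductSpace MatrixOrder Matrix.Norms.L2Operator

/-! ### Projections onto closed convex cones -/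

section Cone

variable {n : ℕ} {C : Set (EuclideanSpace ℝ (Fin n))}

/-- This is the variational inequality of the projection tested at `P_C g + y`: it says that `g -
P_C g` lies in the polar cone. -/
theorem inner_le_inner_metricProj (h0 : 0 ∈ C) (hC : IsClosed C) (hc : Convex ℝ C)
    (hs : ∀ r : ℝ, 0 < r → ∀ y ∈ C, r • y ∈ C) (g : EuclideanSpace ℝ (Fin n))
    {y : EuclideanSpace ℝ (Fin n)} (hy : y ∈ C) :
    ⟪g, y⟫ ≤ ⟪metricProj C g, y⟫ := by
  obtain ⟨hz, hv⟩ := (isNearestPoint_iff hc).1 (metricProj_spec ⟨0, h0⟩ hC hc g)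
  set z := metricProj C g
  have h1 := hv _ (hs 2 two_pos _ hz)
  -- A convex cone is closed under addition: `z + y` is twice the midpoint of `z` and `y`.
  have h2 : z + y ∈ C := by
    have := hs 2 two_pos _ (hc hz hy (by norm_num : (0 : ℝ) ≤ 1 / 2) (by norm_num : (0 : ℝ) ≤ 1 / 2)
      (by norm_num))
    simpa [smul_add, smul_smul] using this
  have h3 := hv _ h2
  simp only [add_sub_cancel_left, inner_sub_left] at h3
  linarith

/-- The two inequalities come from testing against `P_C g` itself and against the origin. -/
theorem inner_metricProj_self (h0 : 0 ∈ C) (hC : IsClosed C) (hc : Convex ℝ C)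
    (hs : ∀ r : ℝ, 0 < r → ∀ y ∈ C, r • y ∈ C) (g : EuclideanSpace ℝ (Fin n)) :
    ⟪g, metricProj C g⟫ = ‖metricProj C g‖ ^ 2 := by
  obtain ⟨hz, hv⟩ := (isNearestPoint_iff hc).1 (metricProj_spec ⟨0, h0⟩ hC hc g)
  refine le_antisymm ?_ ?_
  · exact (inner_le_inner_metricProj h0 hC hc hs g hz).trans_eq (real_inner_self_eq_norm_sq _)
  · have := hv 0 h0
    simp only [inner_sub_left, inner_sub_right, inner_zero_right,
      real_inner_self_eq_norm_sq] at this
    linarith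

theorem inner_le_norm_metricProj_mul (h0 : 0 ∈ C) (hC : IsClosed C) (hc : Convex ℝ C)
    (hs : ∀ r : ℝ, 0 < r → ∀ y ∈ C, r • y ∈ C) (g : EuclideanSpace ℝ (Fin n))
    {y : EuclideanSpace ℝ (Fin n)} (hy : y ∈ C) :
    ⟪g, y⟫ ≤ ‖metricProj C g‖ * ‖y‖ :=
  (inner_le_inner_metricProj h0 hC hc hs g hy).trans (real_inner_le_norm _ _)

/-- The map `g ↦ ‖P_C g‖` is positively homogeneous; this is the inequality needed below. -/
theorem norm_metricProj_smul_le (h0 : 0 ∈ C) (hC : IsClosed C) (hc : Convex ℝ C)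
    (hs : ∀ r : ℝ, 0 < r → ∀ y ∈ C, r • y ∈ C) {c : ℝ} (hc0 : 0 ≤ c)
    (g : EuclideanSpace ℝ (Fin n)) :
    ‖metricProj C (c • g)‖ ≤ c * ‖metricProj C g‖ := by
  have h1 := inner_metricProj_self h0 hC hc hs (c • g)
  have h2 := inner_le_norm_metricProj_mul h0 hC hc hs g
    (metricProj_spec ⟨0, h0⟩ hC hc (c • g)).1
  rw [real_inner_smul_left] at h1
  rcases (norm_nonneg (metricProj C (c • g))).eq_or_lt with h | h
  · rw [← h]; positivity
  · refine le_of_mul_le_mul_right ?_ h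
    nlinarith [mul_le_mul_of_nonneg_left h2 hc0]

/-- If `B ∘ A = id` and `A` maps the closed convex cone `C` into the closed convex cone `D`, then
`‖P_C g‖² ≤ ‖A‖² (‖P_D (B* g + h)‖² + ‖P_D (B* g - h)‖²) / 2`. -/
theorem norm_metricProj_sq_le {p : ℕ} {D : Set (EuclideanSpace ℝ (Fin p))}
    (h0 : 0 ∈ C) (hC : IsClosed C) (hc : Convex ℝ C)
    (hs : ∀ r : ℝ, 0 < r → ∀ y ∈ C, r • y ∈ C)
    (h0' : 0 ∈ D) (hD : IsClosed D) (hd : Convex ℝ D)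
    (hs' : ∀ r : ℝ, 0 < r → ∀ y ∈ D, r • y ∈ D)
    (A : EuclideanSpace ℝ (Fin n) →L[ℝ] EuclideanSpace ℝ (Fin p))
    (B : EuclideanSpace ℝ (Fin p) →L[ℝ] EuclideanSpace ℝ (Fin n))
    (hBA : ∀ x, B (A x) = x) (hA : ∀ x ∈ C, A x ∈ D)
    (g : EuclideanSpace ℝ (Fin n)) (h : EuclideanSpace ℝ (Fin p)) :
    ‖metricProj C g‖ ^ 2 ≤ ‖A‖ ^ 2 * ((‖metricProj D (B.adjoint g + h)‖ ^ 2 +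
      ‖metricProj D (B.adjoint g - h)‖ ^ 2) / 2) := by
  set u := metricProj C g with hu
  have huC : u ∈ C := (metricProj_spec ⟨0, h0⟩ hC hc g).1
  have e : ⟪B.adjoint g, A u⟫ = ‖u‖ ^ 2 := by
    rw [ContinuousLinearMap.adjoint_inner_left, hBA, hu, inner_metricProj_self h0 hC hc hs]
  have h1 := inner_le_norm_metricProj_mul h0' hD hd hs' (B.adjoint g + h) (hA u huC)
  have h2 := inner_le_norm_metricProj_mul h0' hD hd hs' (B.adjoint g - h) (hA u huC)
  rw [inner_add_left, e] at h1
  rw [inner_sub_left, e] at h2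
  set a := ‖metricProj D (B.adjoint g + h)‖ with ha
  set b := ‖metricProj D (B.adjoint g - h)‖ with hb
  have ha0 : 0 ≤ a := norm_nonneg _
  have hb0 : 0 ≤ b := norm_nonneg _
  -- Adding `h1` and `h2` cancels the terms `±⟪h, A u⟫`.
  have h3 : ‖u‖ ^ 2 ≤ (a + b) / 2 * (‖A‖ * ‖u‖) := by
    have := mul_le_mul_of_nonneg_left (A.le_opNorm u) (by positivity : 0 ≤ (a + b) / 2)
    linarith
  have h4 : ‖u‖ ≤ (a + b) / 2 * ‖A‖ := by
    rcases (norm_nonneg u).eq_or_lt with h | h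
    · rw [← h]; positivity
    · refine le_of_mul_le_mul_right ?_ h
      linarith
  calc ‖u‖ ^ 2 ≤ ((a + b) / 2 * ‖A‖) ^ 2 := by gcongr
    _ = ‖A‖ ^ 2 * ((a + b) / 2) ^ 2 := by ring
    _ ≤ ‖A‖ ^ 2 * ((a ^ 2 + b ^ 2) / 2) := by
      gcongr
      nlinarith [sq_nonneg (a - b)]

end Cone

/-! ### Gaussian vectors with dominated covariance -/

theorem charFun_map_continuousLinearMap {E F : Type*} [NormedAddCommGroup E]
    [InnerProductSpace ℝ E] [CompleteSpace E] [MeasurableSpace E] [BorelSpace E]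
    [NormedAddCommGroup F] [InnerProductSpace ℝ F] [CompleteSpace F] [MeasurableSpace F]
    [BorelSpace F] [SecondCountableTopology F]
    (μ : Measure E) (T : E →L[ℝ] F) (t : F) :
    charFun (μ.map T) t = charFun μ (T.adjoint t) := by
  rw [charFun_apply, charFun_apply, integral_map (by fun_prop) (by fun_prop)]
  simp_rw [ContinuousLinearMap.adjoint_inner_right]

/-- The hypothesis is the quadratic form of `T T* + S S* = c² I`. Independence multiplies the
characteristic functions, so the exponents `-‖T* t‖² / 2` and `-‖S* t‖² / 2` add up. -/
theorem map_add_stdGaussian_prod {n p : ℕ} {c : ℝ}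
    (T : EuclideanSpace ℝ (Fin n) →L[ℝ] EuclideanSpace ℝ (Fin p))
    (S : EuclideanSpace ℝ (Fin p) →L[ℝ] EuclideanSpace ℝ (Fin p))
    (h : ∀ t, ‖T.adjoint t‖ ^ 2 + ‖S.adjoint t‖ ^ 2 = c ^ 2 * ‖t‖ ^ 2) :
    ((stdGaussian (EuclideanSpace ℝ (Fin n))).prod (stdGaussian (EuclideanSpace ℝ (Fin p)))).map
        (fun q => T q.1 + S q.2) =
      (stdGaussian (EuclideanSpace ℝ (Fin p))).map (fun g => c • g) := by
  have e : ((stdGaussian (EuclideanSpace ℝ (Fin n))).prod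
      (stdGaussian (EuclideanSpace ℝ (Fin p)))).map (fun q => T q.1 + S q.2) =
      (((stdGaussian _).map T).prod ((stdGaussian _).map S)).map (fun q => q.1 + q.2) := by
    rw [Measure.map_prod_map _ _ (by fun_prop) (by fun_prop),
      Measure.map_map (by fun_prop) (by fun_prop)]
    rfl
  have : IsProbabilityMeasure ((stdGaussian (EuclideanSpace ℝ (Fin n))).map T) :=
    Measure.isProbabilityMeasure_map (by fun_prop)
  have : IsProbabilityMeasure ((stdGaussian (EuclideanSpace ℝ (Fin p))).map S) :=
    Measure.isProbabilityMeasure_map (by fun_prop)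
  have : IsProbabilityMeasure ((stdGaussian (EuclideanSpace ℝ (Fin p))).map (fun g => c • g)) :=
    Measure.isProbabilityMeasure_map (by fun_prop)
  rw [e]
  refine Measure.ext_of_charFun (funext fun t => ?_)
  rw [charFun_map_add_prod_eq_mul, Pi.mul_apply, charFun_map_continuousLinearMap,
    charFun_map_continuousLinearMap, charFun_map_smul, charFun_stdGaussian, charFun_stdGaussian,
    charFun_stdGaussian, ← Complex.exp_add, norm_smul, Real.norm_eq_abs]
  congr 1
  have h1 : (|c| * ‖t‖) ^ 2 = ‖T.adjoint t‖ ^ 2 + ‖S.adjoint t‖ ^ 2 := by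
    rw [mul_pow, sq_abs, h]
  have h2 := congrArg (fun r : ℝ => (r : ℂ)) h1
  push_cast at h2 ⊢
  linear_combination (1 / 2 : ℂ) * h2

/-- Complementary square root: `T T* + S S* = ‖T‖² I` is solvable for `S`. -/
theorem exists_adjoint_norm_sq_add {n p : ℕ}
    (T : EuclideanSpace ℝ (Fin n) →L[ℝ] EuclideanSpace ℝ (Fin p)) :
    ∃ S : EuclideanSpace ℝ (Fin p) →L[ℝ] EuclideanSpace ℝ (Fin p),
      ∀ t, ‖T.adjoint t‖ ^ 2 + ‖S.adjoint t‖ ^ 2 = ‖T‖ ^ 2 * ‖t‖ ^ 2 := by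
  -- `Q` is the covariance still missing from `T T*`; it is positive because `‖T* t‖ ≤ ‖T‖ ‖t‖`.
  set Q : EuclideanSpace ℝ (Fin p) →L[ℝ] EuclideanSpace ℝ (Fin p) :=
    ‖T‖ ^ 2 • ContinuousLinearMap.id ℝ _ - T ∘L T.adjoint with hQ
  have hQt : ∀ s t, ⟪Q s, t⟫ = ‖T‖ ^ 2 * ⟪s, t⟫ - ⟪T.adjoint s, T.adjoint t⟫ := fun s t => by
    simp [hQ, inner_sub_left, real_inner_smul_left, ContinuousLinearMap.adjoint_inner_right]
  have hpos : Q.toLinearMap.IsPositive := by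
    refine ⟨fun s t => ?_, fun t => ?_⟩
    · rw [real_inner_comm _ s]
      simp only [ContinuousLinearMap.coe_coe, hQt]
      rw [real_inner_comm s t, real_inner_comm (T.adjoint s)]
    · simp only [ContinuousLinearMap.coe_coe, hQt, RCLike.re_to_real, real_inner_self_eq_norm_sq]
      have h1 := T.adjoint.le_opNorm t
      rw [LinearIsometryEquiv.norm_map] at h1
      have := pow_le_pow_left₀ (norm_nonneg _) h1 2
      rw [mul_pow] at this
      linarith
  set M : Matrix (Fin p) (Fin p) ℝ := Matrix.toEuclideanLin.symm Q.toLinearMap with hM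
  have hMQ : Matrix.toEuclideanLin M = Q.toLinearMap := by simp [hM]
  have hMpos : M.PosSemidef := by rwa [← Matrix.isPositive_toEuclideanLin_iff, hMQ]
  obtain ⟨N, hN⟩ := CStarAlgebra.nonneg_iff_eq_star_mul_self.mp hMpos.nonneg
  -- With `Q = N* N`, the choice `S = N*` gives `‖S* t‖² = ‖N t‖² = ⟪Q t, t⟫`.
  refine ⟨(Matrix.toEuclideanCLM (𝕜 := ℝ) N).adjoint, fun t => ?_⟩
  have h1 : Matrix.toEuclideanCLM (𝕜 := ℝ) M t = Q t := congrArg (· t) hMQ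
  rw [hN, map_mul, map_star, ContinuousLinearMap.star_eq_adjoint] at h1
  have h2 := hQt t t
  rw [← h1, mul_apply_eq_comp, ContinuousLinearMap.adjoint_inner_left] at h2
  simp only [real_inner_self_eq_norm_sq] at h2
  rw [ContinuousLinearMap.adjoint_adjoint]
  linarith

/-! ### Comparison of statistical dimensions -/

/-- If `B ∘ A = id` and `A` maps the closed convex cone `C` into the closed convex cone `D`, then
`δ(C) ≤ (‖A‖ ‖B‖)² δ(D)`. -/
theorem statDim_le_of_leftInverse {n p : ℕ} {C : Set (EuclideanSpace ℝ (Fin n))}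
    {D : Set (EuclideanSpace ℝ (Fin p))}
    (h0 : 0 ∈ C) (hC : IsClosed C) (hc : Convex ℝ C)
    (hs : ∀ r : ℝ, 0 < r → ∀ y ∈ C, r • y ∈ C)
    (h0' : 0 ∈ D) (hD : IsClosed D) (hd : Convex ℝ D)
    (hs' : ∀ r : ℝ, 0 < r → ∀ y ∈ D, r • y ∈ D)
    (A : EuclideanSpace ℝ (Fin n) →L[ℝ] EuclideanSpace ℝ (Fin p))
    (B : EuclideanSpace ℝ (Fin p) →L[ℝ] EuclideanSpace ℝ (Fin n))
    (hBA : ∀ x, B (A x) = x) (hA : ∀ x ∈ C, A x ∈ D) :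
    statDim C ≤ (‖A‖ * ‖B‖) ^ 2 * statDim D := by
  obtain ⟨S, hS⟩ := exists_adjoint_norm_sq_add B.adjoint
  simp only [LinearIsometryEquiv.norm_map, ContinuousLinearMap.adjoint_adjoint] at hS
  set γ := stdGaussian (EuclideanSpace ℝ (Fin n))
  set γ' := stdGaussian (EuclideanSpace ℝ (Fin p)) with hγ'
  have hcont : Continuous fun y => ‖metricProj D y‖ ^ 2 :=
    (metricProj_lipschitz ⟨0, h0'⟩ hD hd).continuous.norm.pow 2
  have hle : ∀ g, ‖metricProj D (‖B‖ • g)‖ ^ 2 ≤ ‖B‖ ^ 2 * ‖metricProj D g‖ ^ 2 := fun g => by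
    rw [← mul_pow]
    have := norm_metricProj_smul_le h0' hD hd hs' (norm_nonneg B) g
    gcongr
  have hintD := integrable_metricProj_sq h0' hD hd
  have hintB : Integrable (fun g => ‖metricProj D (‖B‖ • g)‖ ^ 2) γ' := by
    refine (hintD.const_mul (‖B‖ ^ 2)).mono' (hcont.comp (continuous_const_smul _)).aestronglyMeasurable
      (ae_of_all _ fun g => ?_)
    rw [Real.norm_of_nonneg (by positivity)]
    exact hle g
  -- Stated for general `R` so that it applies to both `S` and `-S`, which contribute the same
  -- covariance. Integrability and the bound are transported from the law of `‖B‖ g`.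
  have key : ∀ R : EuclideanSpace ℝ (Fin p) →L[ℝ] EuclideanSpace ℝ (Fin p),
      (∀ t, ‖B t‖ ^ 2 + ‖R.adjoint t‖ ^ 2 = ‖B‖ ^ 2 * ‖t‖ ^ 2) →
      Integrable (fun q => ‖metricProj D (B.adjoint q.1 + R q.2)‖ ^ 2) (γ.prod γ') ∧
      ∫ q, ‖metricProj D (B.adjoint q.1 + R q.2)‖ ^ 2 ∂(γ.prod γ') ≤ ‖B‖ ^ 2 * statDim D := by
    intro R hR
    have hmap := map_add_stdGaussian_prod (c := ‖B‖) B.adjoint R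
      (by simpa only [ContinuousLinearMap.adjoint_adjoint] using hR)
    have hm : Measurable fun q : EuclideanSpace ℝ (Fin n) × EuclideanSpace ℝ (Fin p) =>
      B.adjoint q.1 + R q.2 := by fun_prop
    have hm' : Measurable fun g : EuclideanSpace ℝ (Fin p) => ‖B‖ • g := by fun_prop
    constructor
    · refine (integrable_map_measure hcont.aestronglyMeasurable hm.aemeasurable).1 ?_
      rw [hmap]
      exact (integrable_map_measure hcont.aestronglyMeasurable hm'.aemeasurable).2 hintB
    · rw [← integral_map hm.aemeasurable hcont.aestronglyMeasurable, hmap,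
        integral_map hm'.aemeasurable hcont.aestronglyMeasurable, statDim, ← integral_const_mul]
      exact integral_mono hintB (hintD.const_mul _) hle
  obtain ⟨i1, e1⟩ := key S hS
  obtain ⟨i2, e2⟩ := key (-S) (fun t => by simpa using hS t)
  have hpt : ∀ q : EuclideanSpace ℝ (Fin n) × EuclideanSpace ℝ (Fin p),
      ‖metricProj C q.1‖ ^ 2 ≤ ‖A‖ ^ 2 * ((‖metricProj D (B.adjoint q.1 + S q.2)‖ ^ 2 +
        ‖metricProj D (B.adjoint q.1 + (-S) q.2)‖ ^ 2) / 2) := fun q => by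
    rw [neg_apply, ← sub_eq_add_neg]
    exact norm_metricProj_sq_le h0 hC hc hs h0' hD hd hs' A B hBA hA q.1 (S q.2)
  have hfst : statDim C = ∫ q, ‖metricProj C q.1‖ ^ 2 ∂(γ.prod γ') := by
    rw [integral_fun_fst (fun g => ‖metricProj C g‖ ^ 2)]
    simp [statDim, γ, γ']
  calc statDim C = ∫ q, ‖metricProj C q.1‖ ^ 2 ∂(γ.prod γ') := hfst
    _ ≤ ∫ q, ‖A‖ ^ 2 * ((‖metricProj D (B.adjoint q.1 + S q.2)‖ ^ 2 +
        ‖metricProj D (B.adjoint q.1 + (-S) q.2)‖ ^ 2) / 2) ∂(γ.prod γ') :=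
      integral_mono ((integrable_metricProj_sq h0 hC hc).comp_fst γ')
        (((i1.add i2).div_const 2).const_mul _) hpt
    _ = ‖A‖ ^ 2 * ((∫ q, ‖metricProj D (B.adjoint q.1 + S q.2)‖ ^ 2 ∂(γ.prod γ') +
        ∫ q, ‖metricProj D (B.adjoint q.1 + (-S) q.2)‖ ^ 2 ∂(γ.prod γ')) / 2) := by
      rw [integral_const_mul, integral_div, integral_add i1 i2]
    _ ≤ ‖A‖ ^ 2 * (‖B‖ ^ 2 * statDim D) := by
      gcongr
      linarith
    _ = (‖A‖ * ‖B‖) ^ 2 * statDim D := by ring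

/-! ### Descent cones of weighted analysis norms -/

theorem smul_mem_descentCone {E : Type*} [AddCommGroup E] [Module ℝ E] {f : E → ℝ} {x : E}
    {r : ℝ} (hr : 0 < r) {y : E} (hy : y ∈ descentCone f x) : r • y ∈ descentCone f x := by
  simp only [descentCone, Set.mem_iUnion, Set.mem_Ioi, Set.mem_ofPred_eq, exists_prop] at hy ⊢
  obtain ⟨t, ht, h⟩ := hy
  exact ⟨t / r, div_pos ht hr, by rwa [smul_smul, div_mul_cancel₀ _ hr.ne']⟩

theorem apply_mem_descentCone_iff {p n : ℕ} (Ω : Matrix (Fin p) (Fin n) ℝ) (w : Fin p → ℝ)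
    (x z : EuclideanSpace ℝ (Fin n)) :
    apply Ω z ∈ descentCone (weightedL1 w) (apply Ω x) ↔
      z ∈ descentCone (weightedAnalysisL1 Ω w) x := by
  simp only [descentCone, Set.mem_iUnion, Set.mem_Ioi, Set.mem_ofPred_eq, exists_prop,
    weightedAnalysisL1, apply, map_add, map_smul]

theorem apply_apply_of_mul_eq_one {p n : ℕ} {A : Matrix (Fin p) (Fin n) ℝ}
    {B : Matrix (Fin n) (Fin p) ℝ} (h : B * A = 1) (x : EuclideanSpace ℝ (Fin n)) :
    apply B (apply A x) = x := by
  simp [apply, Matrix.toLpLin_apply, Matrix.mulVec_mulVec, h]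

theorem pinv_mul_self {p n : ℕ} {Ω : Matrix (Fin p) (Fin n) ℝ} (h : Ω.rank = n) :
    pinv Ω * Ω = 1 := by
  rw [pinv_eq_of_rank h, Matrix.mul_assoc, Matrix.nonsing_inv_mul _ (isUnit_det_gram h)]

theorem statDim_descentCone_analysis_le {p n : ℕ} {Ω : Matrix (Fin p) (Fin n) ℝ} (h : Ω.rank = n)
    {w : Fin p → ℝ} (hw : ∀ i, 0 ≤ w i) (x : EuclideanSpace ℝ (Fin n)) :
    statDim (descentCone (weightedAnalysisL1 Ω w) x) ≤
      condNumber Ω ^ 2 * statDim (descentCone (weightedL1 w) (apply Ω x)) := by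
  obtain ⟨a, b, c⟩ := descentCone_weighted hw (Matrix.toEuclideanLin Ω) x
  obtain ⟨a', b', c'⟩ := descentCone_weighted hw LinearMap.id (apply Ω x)
  exact statDim_le_of_leftInverse a b c (fun r hr y hy => smul_mem_descentCone hr hy)
    a' b' c' (fun r hr y hy => smul_mem_descentCone hr hy)
    (LinearMap.toContinuousLinearMap (Matrix.toEuclideanLin Ω))
    (LinearMap.toContinuousLinearMap (Matrix.toEuclideanLin (pinv Ω)))
    (apply_apply_of_mul_eq_one (pinv_mul_self h))
    (fun z hz => (apply_mem_descentCone_iff Ω w x z).2 hz)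

/-- Here `Ω†` is the map between the cones and `Ω` its left inverse; the product of the two norms is
unchanged. -/
theorem statDim_descentCone_le_analysis {p n : ℕ} {Ω : Matrix (Fin p) (Fin n) ℝ}
    (h : Ω * pinv Ω = 1) {w : Fin p → ℝ} (hw : ∀ i, 0 ≤ w i) (x : EuclideanSpace ℝ (Fin n)) :
    statDim (descentCone (weightedL1 w) (apply Ω x)) ≤
      condNumber Ω ^ 2 * statDim (descentCone (weightedAnalysisL1 Ω w) x) := by
  obtain ⟨a, b, c⟩ := descentCone_weighted hw (Matrix.toEuclideanLin Ω) x
  obtain ⟨a', b', c'⟩ := descentCone_weighted hw LinearMap.id (apply Ω x)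
  rw [condNumber, mul_comm (opNorm Ω)]
  refine statDim_le_of_leftInverse a' b' c' (fun r hr y hy => smul_mem_descentCone hr hy)
    a b c (fun r hr y hy => smul_mem_descentCone hr hy)
    (LinearMap.toContinuousLinearMap (Matrix.toEuclideanLin (pinv Ω)))
    (LinearMap.toContinuousLinearMap (Matrix.toEuclideanLin Ω))
    (apply_apply_of_mul_eq_one h) (fun z hz => ?_)
  refine (apply_mem_descentCone_iff Ω w x _).1 ?_
  have hz' : apply Ω (apply (pinv Ω) z) = z := apply_apply_of_mul_eq_one h z
  exact (congrArg (· ∈ descentCone (weightedL1 w) (apply Ω x)) hz').mpr hz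

theorem statDim_nonneg {n : ℕ} (C : Set (EuclideanSpace ℝ (Fin n))) : 0 ≤ statDim C :=
  integral_nonneg fun _ => by positivity

end AnalysisRecovery

theorem proposition1 :
    (∀ (p n : ℕ), n ≤ p → ∀ (Ω : Matrix (Fin p) (Fin n) ℝ), Ω.rank = n →
      ∀ (w : Fin p → ℝ), (∀ i, 0 ≤ w i) →
      ∀ (s : ℕ) (x : EuclideanSpace ℝ (Fin n)), AnalysisRecovery.IsAnalysisSparse Ω s x →
        AnalysisRecovery.statDim
            (AnalysisRecovery.descentCone (AnalysisRecovery.weightedAnalysisL1 Ω w) x)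
          ≤ AnalysisRecovery.condNumber Ω ^ 2 *
            AnalysisRecovery.statDim
              (AnalysisRecovery.descentCone (AnalysisRecovery.weightedL1 w)
                (AnalysisRecovery.apply Ω x))) ∧
    (∀ (n : ℕ) (Ω : Matrix (Fin n) (Fin n) ℝ), IsUnit Ω →
      ∀ (w : Fin n → ℝ), (∀ i, 0 ≤ w i) →
      ∀ (s : ℕ) (x : EuclideanSpace ℝ (Fin n)), AnalysisRecovery.IsAnalysisSparse Ω s x →
        1 / AnalysisRecovery.condNumber Ω ^ 2 *
            AnalysisRecovery.statDim
              (AnalysisRecovery.descentCone (AnalysisRecovery.weightedL1 w)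
                (AnalysisRecovery.apply Ω x))
          ≤ AnalysisRecovery.statDim
            (AnalysisRecovery.descentCone (AnalysisRecovery.weightedAnalysisL1 Ω w) x) ∧
        AnalysisRecovery.statDim
            (AnalysisRecovery.descentCone (AnalysisRecovery.weightedAnalysisL1 Ω w) x)
          ≤ AnalysisRecovery.condNumber Ω ^ 2 *
            AnalysisRecovery.statDim
              (AnalysisRecovery.descentCone (AnalysisRecovery.weightedL1 w)
                (AnalysisRecovery.apply Ω x))) := by
  refine ⟨fun p n _ Ω hr w hw s x _ => AnalysisRecovery.statDim_descentCone_analysis_le hr hw x,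
    fun n Ω hu w hw s x _ => ?_⟩
  have hr : Ω.rank = n := by simpa using Matrix.rank_of_isUnit Ω hu
  refine ⟨?_, AnalysisRecovery.statDim_descentCone_analysis_le hr hw x⟩
  -- For square matrices the left inverse `Ω†` is also a right inverse.
  have h := AnalysisRecovery.statDim_descentCone_le_analysis
    (mul_eq_one_comm.1 (AnalysisRecovery.pinv_mul_self hr)) hw x
  rw [one_div_mul_eq_div]
  -- For `n = 0` the condition number is `0`, so the quotient is `0` by convention and only
  -- nonnegativity of the statistical dimension is needed.
  exact div_le_of_le_mul₀ (by positivity) (AnalysisRecovery.statDim_nonneg _)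
    (h.trans_eq (mul_comm _ _))
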